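/- Let $q\ge 2$ be an integer, $Q=\frac{q}{q-1}$, $\lambda=\ln q$, and for integers $d,k\ge 1$ put \[ h(p)=\frac{d\ln(1-Qp)-k\ln q+\ln(q-1)}{\ln(1-p)},\qquad 0<p<\tfrac{q-1}{q}. \] The function $h$ attains its minimum on $(0,\frac{q-1}{q})$ at exactly one point; let $p_m$ be this point and let $\mu(d,k)=h(p_m)$ be the minimum. Put \[ \kappa=k\ln q-\ln(q-1),\qquad \theta=\frac{d}{\kappa},\qquad \Lambda=\ln\Bigl(\frac{\theta\lambda}{q-1}\Bigr). \] There exist real polynomials $A_1,A_2,\ldots$ and $B_0,B_1,\ldots$, depending only on $q$, with \begin{align*} A_1(x)&=1,\\ A_2(x)&=x+\lambda-1,\\ A_3(x)&=\tfrac12\bigl(2x^2+(4\lambda-2)x+2\lambda^2-3\lambda\bigr),\\ B_0(x)&=1,\\ B_1(x)&=-(x-1),\\ B_2(x)&=-\tfrac12(2x+\lambda-2),\\ B_3(x)&=-\tfrac16(3x^2+3\lambda x+\lambda^2-3), \end{align*} such that, for every integer $r\ge 0$, as $k\to\infty$ and $d/k\to 0$ (with $d\ge 1$), \[ 1-Qp_m=\frac{\lambda}{q-1}\sum_{i=1}^{r}A_i(\Lambda)\,\theta^i+O\bigl(\theta^{r+1}|\Lambda|^{r}\bigr)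 \] and \[ \mu(d,k)=\frac{\kappa}{\lambda}\sum_{i=0}^{r}B_i(\Lambda)\,\theta^i+O\bigl(\kappa\,\theta^{r+1}|\Lambda|^{\max(1,r)}\bigr). \] The implied constants depend only on $q$ and $r$; they are uniform in $(d,k)$ once $k$ is large enough and $d/k$ is small enough (with thresholds depending only on $q$ and $r$). -/

import Mathlib

open Filter Topology Asymptotics Polynomial

noncomputable section

namespace ErrorDetection

/-- The constant `Q = q / (q - 1)`. -/
def Q (q : ℕ) : ℝ := (q : ℝ) / ((q : ℝ) - 1)

/-- The function `h(p) = (d ln(1 - Qp) - k ln q + ln(q - 1)) / ln(1 - p)`. -/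
def h (q d k : ℕ) (p : ℝ) : ℝ :=
  ((d : ℝ) * Real.log (1 - Q q * p) - (k : ℝ) * Real.log q + Real.log ((q : ℝ) - 1)) /
    Real.log (1 - p)

/-- The open interval `(0, (q - 1)/q)` of symbol error probabilities. -/
def probInterval (q : ℕ) : Set ℝ := Set.Ioo 0 (((q : ℝ) - 1) / q)

/-- `p` is a point of `(0, (q - 1)/q)` at which `h` attains its minimum over this interval. -/
def IsMinimizer (q d k : ℕ) (p : ℝ) : Prop :=
  p ∈ probInterval q ∧ IsMinOn (h q d k) (probInterval q) p

/-- `p_m`, the point of `(0, (q - 1)/q)` at which `h` attains its minimum. -/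
def pMin (q d k : ℕ) : ℝ := Classical.epsilon (IsMinimizer q d k)

/-- `μ(d, k)`, the minimum of `h` over `(0, (q - 1)/q)`. -/
def mu (q d k : ℕ) : ℝ := sInf (h q d k '' probInterval q)

/-- `κ = k ln q - ln(q - 1)`. -/
def kappa (q k : ℕ) : ℝ := (k : ℝ) * Real.log q - Real.log ((q : ℝ) - 1)

/-- `λ = ln q`. -/
def lam (q : ℕ) : ℝ := Real.log q

/-- `θ = d / κ`. -/
def theta (q d k : ℕ) : ℝ := (d : ℝ) / kappa q k

/-- `Λ = ln(θ λ / (q - 1))`. -/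
def Lam (q d k : ℕ) : ℝ := Real.log (theta q d k * lam q / ((q : ℝ) - 1))

/-- The regime `k → ∞`, `d / k → 0` for pairs `(d, k)` with `d ≥ 1`. -/
def regime : Filter (ℕ × ℕ) :=
  𝓟 {x : ℕ × ℕ | 1 ≤ x.1} ⊓ comap (fun x : ℕ × ℕ => x.2) atTop ⊓
    comap (fun x : ℕ × ℕ => (x.1 : ℝ) / (x.2 : ℝ)) (𝓝 0)

end ErrorDetection

end

/-!
In the variable `u = 1 - Q p`, with `c = q - 1` and `l = ln q`, the function `h` is `κ` times
`(1 - θ ln u) / (l - ln (1 + c u))` on `(0, 1)`. The sign of its derivative is that of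
`criticalFun`, which is strictly increasing and changes sign. So there is exactly one minimizer, and
*any* zero of `criticalFun` in `(0, 1)` is that minimizer (`isMinimizer_iff`).

The substitution `z = l θ / (c u)` turns the critical equation into
`1 + t ln z - (z + l t) (1 - (ln (z + l t) - ln z) / l) = s` with `t = θ` and `s = θ Λ`, and the
minimum into `(κ / l) (z + l θ)`, see `pMin_and_mu_of_levelFun`. The equation is solved at `z = 1`,
`s = t = 0`, where the differential of `(z, t) ↦ (s, t)` is invertible. The inverse function theorem
gives a solution `z = Z (s, t)` analytic near the origin (`exists_analytic_solution`). As `θ → 0`,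
also `θ Λ → 0`, and by uniqueness of the minimizer `Z (θ Λ, θ)` is the value of `z` there; no
preliminary localization of the minimizer is needed.

The power series of `1 / Z` and of `Z + l t` are sums of homogeneous polynomials in `(s, t)`. The
component of degree `i` at `(θ Λ, θ)` is `θ ^ i` times a polynomial of degree at most `i` in `Λ`;
these are the `A (i + 1)` and the `B i`, and the remainder after the components of degree less than
`n` is `O((θ |Λ|) ^ n)`. As `Z (s, 0) = 1 - s`, the polynomial `B i` has degree at most `i - 1` for
`i ≥ 2`. With the boundedness of `θ Λ ^ 2` this gives the sharper exponent `max 1 r` in the error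
term for `μ` (`truncation_isBigO`).

For the explicit polynomials, `x` is fixed and the equation is restricted to the ray `s = x t`, where
the Taylor expansions of both sides at order three can be compared (`jet_coeffs`).
-/

noncomputable section

namespace ErrorDetection

/-! ### The minimum of `h` -/

/-- The function `h / κ` in the variable `u = 1 - Q p`, with `c = q - 1`, `l = ln q` and
`t = θ`. -/
def reducedH (c l t u : ℝ) : ℝ :=
  (1 - t * Real.log u) / (l - Real.log (1 + c * u))

/-- For `l = ln (1 + c)`, a positive multiple of the derivative of `reducedH` on `(0, 1)`; see
`hasDerivAt_reducedH`. -/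
def criticalFun (c l t u : ℝ) : ℝ :=
  c * u * (1 - t * Real.log u) - t * (l - Real.log (1 + c * u)) * (1 + c * u)

/-- Continuity holds up to `u = 0`, since `u ln u` extends continuously by the value `0`. -/
lemma continuousOn_criticalFun {c : ℝ} (hc : 0 < c) (l t : ℝ) :
    ContinuousOn (criticalFun c l t) (Set.Icc 0 1) := by
  have h1 : criticalFun c l t = fun u => c * u - c * t * (u * Real.log u)
      - t * (l - Real.log (1 + c * u)) * (1 + c * u) := by
    funext u; simp only [criticalFun]; ring
  rw [h1]
  have h2 := Real.continuous_mul_log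
  have h3 : ContinuousOn (fun u : ℝ => Real.log (1 + c * u)) (Set.Icc 0 1) := by
    apply ContinuousOn.log (by fun_prop)
    intro u hu
    have := mul_nonneg hc.le hu.1
    positivity
  fun_prop

/-- `l - ln (1 + c u)` is positive on `(0, 1)` when `l = ln (1 + c)`. -/
lemma denom_pos {c u : ℝ} (hc : 0 < c) (hu : 0 < u) (hu1 : u < 1) :
    0 < Real.log (1 + c) - Real.log (1 + c * u) := by
  have : 0 < c * u := by positivity
  rw [sub_pos]
  apply Real.log_lt_log (by positivity)
  nlinarith

lemma hasDerivAt_criticalFun {c u : ℝ} (hc : 0 < c) (hu : 0 < u) (l t : ℝ) :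
    HasDerivAt (criticalFun c l t)
      (c * (1 - t * (Real.log u + l - Real.log (1 + c * u)))) u := by
  have h0 : 0 < 1 + c * u := by positivity
  have h1 : HasDerivAt (fun u : ℝ => 1 + c * u) c u := by
    simpa using ((hasDerivAt_id u).const_mul c).const_add 1
  have h2 := h1.log h0.ne'
  have h3 := Real.hasDerivAt_log hu.ne'
  have h4 := (((hasDerivAt_id u).const_mul c).mul ((h3.const_mul t).const_sub 1)).sub
    (((h2.const_sub l).const_mul t).mul h1)
  refine h4.congr_deriv ?_
  simp only [id]
  field_simp
  ring

lemma strictMonoOn_criticalFun {c t : ℝ} (hc : 0 < c) (ht : 0 < t) :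
    StrictMonoOn (criticalFun c (Real.log (1 + c)) t) (Set.Icc 0 1) := by
  refine strictMonoOn_of_deriv_pos (convex_Icc 0 1) (continuousOn_criticalFun hc _ t) ?_
  rw [interior_Icc]
  rintro u ⟨hu, hu1⟩
  rw [(hasDerivAt_criticalFun hc hu _ t).deriv]
  have h0 : 0 < c * u := by positivity
  have h1 : Real.log u + Real.log (1 + c) < Real.log (1 + c * u) := by
    rw [← Real.log_mul hu.ne' (by positivity)]
    exact Real.log_lt_log (by positivity) (by nlinarith)
  have h2 : t * (Real.log u + Real.log (1 + c) - Real.log (1 + c * u)) < 0 :=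
    mul_neg_of_pos_of_neg ht (by linarith)
  exact mul_pos hc (by linarith)

lemma exists_criticalFun_eq_zero {c t : ℝ} (hc : 0 < c) (ht : 0 < t) :
    ∃ u ∈ Set.Ioo (0 : ℝ) 1, criticalFun c (Real.log (1 + c)) t u = 0 := by
  have h0 : criticalFun c (Real.log (1 + c)) t 0 < 0 := by
    have : 0 < Real.log (1 + c) := Real.log_pos (by linarith)
    simp only [criticalFun]
    norm_num
    positivity
  have h1 : 0 < criticalFun c (Real.log (1 + c)) t 1 := by
    simpa [criticalFun] using hc
  exact intermediate_value_Ioo zero_le_one (continuousOn_criticalFun hc _ t) ⟨h0, h1⟩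

lemma hasDerivAt_reducedH {c t u : ℝ} (hc : 0 < c) (hu : 0 < u) (hu1 : u < 1) :
    HasDerivAt (reducedH c (Real.log (1 + c)) t)
      (criticalFun c (Real.log (1 + c)) t u /
        (u * (1 + c * u) * (Real.log (1 + c) - Real.log (1 + c * u)) ^ 2)) u := by
  have h0 : 0 < 1 + c * u := by positivity
  have hd := denom_pos hc hu hu1
  have h1 : HasDerivAt (fun u : ℝ => 1 + c * u) c u := by
    simpa using ((hasDerivAt_id u).const_mul c).const_add 1
  have h2 := h1.log h0.ne'
  have h3 := Real.hasDerivAt_log hu.ne'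
  have h4 := ((h3.const_mul t).const_sub 1).div (h2.const_sub (Real.log (1 + c))) hd.ne'
  refine h4.congr_deriv ?_
  simp only [criticalFun]
  field_simp
  ring

/-- The zero of `criticalFun` is the strict minimum of `reducedH`. -/
lemma reducedH_lt {c t u v : ℝ} (hc : 0 < c) (ht : 0 < t) (hu : u ∈ Set.Ioo (0 : ℝ) 1)
    (h0 : criticalFun c (Real.log (1 + c)) t u = 0) (hv : v ∈ Set.Ioo (0 : ℝ) 1) (hvu : v ≠ u) :
    reducedH c (Real.log (1 + c)) t u < reducedH c (Real.log (1 + c)) t v := by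
  have hmono := strictMonoOn_criticalFun hc ht
  have hIcc : ∀ {x : ℝ}, x ∈ Set.Ioo (0 : ℝ) 1 → x ∈ Set.Icc (0 : ℝ) 1 :=
    fun h => Set.Ioo_subset_Icc_self h
  have hpos : ∀ {x : ℝ}, x ∈ Set.Ioo (0 : ℝ) 1 →
      0 < x * (1 + c * x) * (Real.log (1 + c) - Real.log (1 + c * x)) ^ 2 := by
    intro x hx
    have := denom_pos hc hx.1 hx.2
    have := hx.1
    positivity
  rcases lt_or_gt_of_ne hvu with h | h
  · have hsub : Set.Icc v u ⊆ Set.Ioo (0 : ℝ) 1 :=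
      fun x hx => ⟨hv.1.trans_le hx.1, hx.2.trans_lt hu.2⟩
    refine strictAntiOn_of_deriv_neg (convex_Icc v u) (fun x hx =>
      (hasDerivAt_reducedH hc (hsub hx).1 (hsub hx).2).continuousAt.continuousWithinAt) ?_
      (Set.left_mem_Icc.2 h.le) (Set.right_mem_Icc.2 h.le) h
    rw [interior_Icc]
    intro x hx
    have hx' := hsub (Set.Ioo_subset_Icc_self hx)
    rw [(hasDerivAt_reducedH hc hx'.1 hx'.2).deriv]
    exact div_neg_of_neg_of_pos (h0 ▸ hmono (hIcc hx') (hIcc hu) hx.2) (hpos hx')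
  · have hsub : Set.Icc u v ⊆ Set.Ioo (0 : ℝ) 1 :=
      fun x hx => ⟨hu.1.trans_le hx.1, hx.2.trans_lt hv.2⟩
    refine strictMonoOn_of_deriv_pos (convex_Icc u v) (fun x hx =>
      (hasDerivAt_reducedH hc (hsub hx).1 (hsub hx).2).continuousAt.continuousWithinAt) ?_
      (Set.left_mem_Icc.2 h.le) (Set.right_mem_Icc.2 h.le) h
    rw [interior_Icc]
    intro x hx
    have hx' := hsub (Set.Ioo_subset_Icc_self hx)
    rw [(hasDerivAt_reducedH hc hx'.1 hx'.2).deriv]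
    exact div_pos (h0 ▸ hmono (hIcc hu) (hIcc hx') hx.1) (hpos hx')

lemma log_one_add_natCast_sub_one (q : ℕ) : Real.log (1 + ((q : ℝ) - 1)) = lam q := by
  simp [lam]

lemma natCast_sub_one_pos {q : ℕ} (hq : 2 ≤ q) : 0 < (q : ℝ) - 1 := by
  have : (2 : ℝ) ≤ q := by exact_mod_cast hq
  linarith

lemma lam_pos {q : ℕ} (hq : 2 ≤ q) : 0 < lam q :=
  Real.log_pos (by have := natCast_sub_one_pos hq; linarith)

lemma log_sub_one_lt_lam {q : ℕ} (hq : 2 ≤ q) : Real.log ((q : ℝ) - 1) < lam q :=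
  Real.log_lt_log (natCast_sub_one_pos hq) (by linarith)

lemma kappa_pos {q k : ℕ} (hq : 2 ≤ q) (hk : 1 ≤ k) : 0 < kappa q k := by
  have h1 := log_sub_one_lt_lam hq
  have h2 := lam_pos hq
  have h3 : (1 : ℝ) ≤ k := by exact_mod_cast hk
  have : lam q ≤ k * lam q := le_mul_of_one_le_left h2.le h3
  simp only [kappa, lam] at *
  linarith

lemma theta_pos {q d k : ℕ} (hq : 2 ≤ q) (hd : 1 ≤ d) (hk : 1 ≤ k) : 0 < theta q d k :=
  div_pos (by exact_mod_cast hd) (kappa_pos hq hk)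

lemma mem_probInterval_iff {q : ℕ} (hq : 2 ≤ q) (p : ℝ) :
    p ∈ probInterval q ↔ 1 - Q q * p ∈ Set.Ioo (0 : ℝ) 1 := by
  have h1 := natCast_sub_one_pos hq
  have h2 : (0 : ℝ) < q := by linarith
  have h3 : 0 < Q q := div_pos h2 h1
  have h4 : ((q : ℝ) - 1) / q = 1 / Q q := by simp [Q]
  rw [probInterval, Set.mem_Ioo, Set.mem_Ioo, h4, lt_div_iff₀ h3, sub_pos, sub_lt_self_iff,
    mul_pos_iff_of_pos_left h3, mul_comm p, and_comm]

lemma h_eq {q d k : ℕ} (hq : 2 ≤ q) (hk : 1 ≤ k) {p : ℝ} (hp : p ∈ probInterval q) :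
    h q d k p = kappa q k * reducedH ((q : ℝ) - 1) (lam q) (theta q d k) (1 - Q q * p) := by
  have hc := natCast_sub_one_pos hq
  have hq0 : (0 : ℝ) < q := by linarith
  have hu := (mem_probInterval_iff hq p).1 hp
  have hd := denom_pos hc hu.1 hu.2
  rw [log_one_add_natCast_sub_one] at hd
  have hκ := kappa_pos hq hk
  have h1 : 1 - p = (1 + ((q : ℝ) - 1) * (1 - Q q * p)) / q := by
    simp only [Q]; field_simp; ring
  have h2 : 0 < 1 + ((q : ℝ) - 1) * (1 - Q q * p) := by
    have := mul_pos hc hu.1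
    linarith
  have h3 : Real.log (1 - p) = -(lam q - Real.log (1 + ((q : ℝ) - 1) * (1 - Q q * p))) := by
    rw [h1, Real.log_div h2.ne' hq0.ne', lam]; ring
  have h4 : kappa q k * (1 - theta q d k * Real.log (1 - Q q * p)) =
      kappa q k - d * Real.log (1 - Q q * p) := by
    simp only [theta]; field_simp
  rw [h, h3, reducedH, ← mul_div_assoc, h4, div_neg, ← neg_div]
  congr 1
  simp only [kappa]
  ring

/-- A zero of `criticalFun` gives the unique minimizer of `h`, in terms of `u = 1 - Q p`. -/
lemma isMinimizer_iff {q d k : ℕ} (hq : 2 ≤ q) (hd : 1 ≤ d) (hk : 1 ≤ k) {u : ℝ}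
    (hu : u ∈ Set.Ioo (0 : ℝ) 1) (h0 : criticalFun ((q : ℝ) - 1) (lam q) (theta q d k) u = 0)
    (p : ℝ) : IsMinimizer q d k p ↔ 1 - Q q * p = u := by
  have hc := natCast_sub_one_pos hq
  have hQ : Q q ≠ 0 := (div_pos (by linarith) hc).ne'
  have hκ := kappa_pos hq hk
  have hlt : ∀ {v : ℝ}, v ∈ Set.Ioo (0 : ℝ) 1 → v ≠ u →
      reducedH ((q : ℝ) - 1) (lam q) (theta q d k) u <
        reducedH ((q : ℝ) - 1) (lam q) (theta q d k) v := by
    rw [← log_one_add_natCast_sub_one] at h0 ⊢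
    exact reducedH_lt hc (theta_pos hq hd hk) hu h0
  constructor
  · rintro ⟨hp, hmin⟩
    by_contra hne
    have hpu : 1 - Q q * ((1 - u) / Q q) = u := by field_simp; ring
    have hmem : (1 - u) / Q q ∈ probInterval q := by
      rw [mem_probInterval_iff hq, hpu]; exact hu
    have h1 : h q d k p ≤ h q d k ((1 - u) / Q q) := hmin hmem
    rw [h_eq hq hk hp, h_eq hq hk hmem, hpu, mul_le_mul_iff_right₀ hκ] at h1
    exact absurd (hlt ((mem_probInterval_iff hq p).1 hp) hne) (not_lt.2 h1)
  · intro hpu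
    have hp : p ∈ probInterval q := by rw [mem_probInterval_iff hq, hpu]; exact hu
    refine ⟨hp, fun p' hp' => ?_⟩
    show h q d k p ≤ h q d k p'
    rw [h_eq hq hk hp, h_eq hq hk hp', hpu, mul_le_mul_iff_right₀ hκ]
    by_cases hne : 1 - Q q * p' = u
    · rw [hne]
    · exact (hlt ((mem_probInterval_iff hq p').1 hp') hne).le

lemma existsUnique_isMinimizer {q d k : ℕ} (hq : 2 ≤ q) (hd : 1 ≤ d) (hk : 1 ≤ k) :
    ∃! p : ℝ, IsMinimizer q d k p := by
  have hc := natCast_sub_one_pos hq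
  have hQ : Q q ≠ 0 := (div_pos (by linarith) hc).ne'
  obtain ⟨u, hu, h0⟩ := exists_criticalFun_eq_zero hc (theta_pos hq hd hk)
  rw [log_one_add_natCast_sub_one] at h0
  refine ⟨(1 - u) / Q q, (isMinimizer_iff hq hd hk hu h0 _).2 (by field_simp; ring), ?_⟩
  intro p hp
  rw [isMinimizer_iff hq hd hk hu h0] at hp
  field_simp
  linarith

lemma isMinimizer_pMin {q d k : ℕ} (hq : 2 ≤ q) (hd : 1 ≤ d) (hk : 1 ≤ k) :
    IsMinimizer q d k (pMin q d k) :=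
  Classical.epsilon_spec (existsUnique_isMinimizer hq hd hk).exists

lemma isLeast_h_pMin {q d k : ℕ} (hq : 2 ≤ q) (hd : 1 ≤ d) (hk : 1 ≤ k) :
    IsLeast (h q d k '' probInterval q) (h q d k (pMin q d k)) := by
  obtain ⟨hp, hmin⟩ := isMinimizer_pMin hq hd hk
  refine ⟨⟨_, hp, rfl⟩, ?_⟩
  rintro _ ⟨p, hp', rfl⟩
  exact hmin hp'

lemma mu_eq {q d k : ℕ} (hq : 2 ≤ q) (hd : 1 ≤ d) (hk : 1 ≤ k) :
    mu q d k = h q d k (pMin q d k) :=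
  (isLeast_h_pMin hq hd hk).csInf_eq

/-! ### Homogeneous expansions of analytic functions of two variables -/

/-- The homogenization of degree `i` of the polynomial `P`, as a function on the plane:
`y ↦ y.2 ^ i * P (y.1 / y.2)`, written without division. -/
def homogEval (P : ℝ[X]) (i : ℕ) (y : ℝ × ℝ) : ℝ :=
  ∑ j ∈ Finset.range (i + 1), P.coeff j * y.1 ^ j * y.2 ^ (i - j)

lemma homogEval_mul_self {P : ℝ[X]} {i : ℕ} (hP : P.natDegree ≤ i) (x t : ℝ) :
    homogEval P i (t * x, t) = P.eval x * t ^ i := by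
  rw [homogEval, Polynomial.eval_eq_sum_range' (Nat.lt_succ_of_le hP), Finset.sum_mul]
  refine Finset.sum_congr rfl fun j hj => ?_
  have hj' : j ≤ i := Nat.lt_succ_iff.1 (Finset.mem_range.1 hj)
  have : t ^ i = t ^ j * t ^ (i - j) := by rw [← pow_add, Nat.add_sub_cancel' hj']
  simp only [this, mul_pow]
  ring

lemma homogEval_snd_zero (P : ℝ[X]) (i : ℕ) (s : ℝ) :
    homogEval P i (s, 0) = P.coeff i * s ^ i := by
  rw [homogEval, Finset.sum_range_succ, Finset.sum_eq_zero]
  · simp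
  · intro j hj
    have : i - j ≠ 0 := Nat.sub_ne_zero_of_lt (Finset.mem_range.1 hj)
    simp [this]

/-- The restriction to the diagonal of an `i`-linear form on the plane is a homogeneous polynomial of
degree `i`: the coefficient of `s ^ j t ^ (i - j)` collects the values of the form with `(1, 0)` in
`j` places and `(0, 1)` in the others. -/
lemma exists_homogEval_eq_multilinear {i : ℕ} (p : (ℝ × ℝ) [×i]→L[ℝ] ℝ) :
    ∃ P : ℝ[X], P.natDegree ≤ i ∧ ∀ y, p (fun _ => y) = homogEval P i y := by
  classical
  let a : Finset (Fin i) → ℝ := fun S => p (S.piecewise (fun _ => (1, 0)) fun _ => (0, 1))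
  have hcard : ∀ S : Finset (Fin i), S.card ≤ i := fun S => by
    simpa using S.card_le_univ
  refine ⟨∑ S : Finset (Fin i), monomial S.card (a S), ?_, ?_⟩
  · exact Polynomial.natDegree_sum_le_of_forall_le _ _ fun S _ =>
      (Polynomial.natDegree_monomial_le _).trans (hcard S)
  · rintro ⟨s, t⟩
    have hy : (fun _ : Fin i => (s, t)) =
        (fun _ : Fin i => s • ((1, 0) : ℝ × ℝ)) + fun _ => t • ((0, 1) : ℝ × ℝ) := by
      funext _; simp
    have hS : ∀ S : Finset (Fin i),
        p (S.piecewise (fun _ : Fin i => s • ((1, 0) : ℝ × ℝ)) fun _ => t • ((0, 1) : ℝ × ℝ)) =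
          a S * s ^ S.card * t ^ (i - S.card) := by
      intro S
      have h1 : (S.piecewise (fun _ : Fin i => s • ((1, 0) : ℝ × ℝ)) fun _ => t • ((0, 1) : ℝ × ℝ))
          = fun k => (S.piecewise (fun _ => s) (fun _ => t) k : ℝ) •
            (S.piecewise (fun _ => ((1, 0) : ℝ × ℝ)) (fun _ => (0, 1)) k) := by
        funext k
        by_cases hk : k ∈ S <;> simp [hk]
      rw [h1, p.map_smul_univ, Finset.prod_piecewise]
      have h2 : (Finset.univ \ S).card = i - S.card := by
        rw [Finset.card_sdiff_of_subset (Finset.subset_univ S), Finset.card_univ, Fintype.card_fin]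
      simp only [Finset.univ_inter, Finset.prod_const, h2, smul_eq_mul, a]
      ring
    rw [hy, p.map_add_univ, homogEval]
    simp only [hS, Polynomial.finsetSum_coeff, Finset.sum_mul]
    rw [Finset.sum_comm]
    refine Finset.sum_congr rfl fun S _ => ?_
    rw [Finset.sum_eq_single_of_mem S.card (Finset.mem_range.2 (Nat.lt_succ_of_le (hcard S)))]
    · simp
    · intro j _ hj
      rw [Polynomial.coeff_monomial_of_ne _ hj]
      simp

/-- A function analytic at the origin of the plane is asymptotic to a series of homogeneous
polynomials, each encoded by its dehomogenization. -/
lemma exists_homogeneous_expansion {f : ℝ × ℝ → ℝ} (hf : AnalyticAt ℝ f 0) :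
    ∃ P : ℕ → ℝ[X], (∀ i, (P i).natDegree ≤ i) ∧ ∀ n : ℕ,
      (fun y : ℝ × ℝ => f y - ∑ i ∈ Finset.range n, homogEval (P i) i y) =O[𝓝 0]
        fun y => ‖y‖ ^ n := by
  obtain ⟨p, hp⟩ := hf
  choose P hdeg hP using fun i => exists_homogEval_eq_multilinear (p i)
  refine ⟨P, hdeg, fun n => ?_⟩
  simpa [FormalMultilinearSeries.partialSum, hP] using hp.isBigO_sub_partialSum_pow n

/-! ### Taylor expansions in one variable -/

/-- A polynomial of degree less than `n` that is `O(t ^ n)` at `0` vanishes. -/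
lemma coeff_eq_zero_of_sum_isBigO {n : ℕ} {c : ℕ → ℝ}
    (h : (fun t : ℝ => ∑ i ∈ Finset.range n, c i * t ^ i) =O[𝓝[≠] 0] fun t => t ^ n) :
    ∀ i < n, c i = 0 := by
  induction n generalizing c with
  | zero => intro i hi; omega
  | succ n ih =>
    have hcont : Tendsto (fun t : ℝ => ∑ i ∈ Finset.range (n + 1), c i * t ^ i) (𝓝[≠] 0)
        (𝓝 (c 0)) := by
      have h1 : Continuous fun t : ℝ => ∑ i ∈ Finset.range (n + 1), c i * t ^ i := by fun_prop
      have h2 := h1.tendsto 0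
      rw [Finset.sum_range_succ'] at h2
      simp only [ne_eq, Nat.add_eq_zero_iff, one_ne_zero, and_false, not_false_eq_true, zero_pow,
        mul_zero, Finset.sum_const_zero, pow_zero, mul_one, zero_add] at h2
      exact h2.mono_left nhdsWithin_le_nhds
    have hpow : Tendsto (fun t : ℝ => t ^ (n + 1)) (𝓝[≠] 0) (𝓝 0) := by
      have h1 : Continuous fun t : ℝ => t ^ (n + 1) := by fun_prop
      have h2 := h1.tendsto 0
      simp only [ne_eq, Nat.add_eq_zero_iff, one_ne_zero, and_false, not_false_eq_true,
        zero_pow] at h2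
      exact h2.mono_left nhdsWithin_le_nhds
    have h0 : c 0 = 0 := tendsto_nhds_unique hcont (h.trans_tendsto hpow)
    have hsucc : (fun t : ℝ => ∑ i ∈ Finset.range n, c (i + 1) * t ^ i) =O[𝓝[≠] 0]
        fun t => t ^ n := by
      have h1 := (isBigO_refl (fun t : ℝ => t⁻¹) (𝓝[≠] 0)).mul h
      refine h1.congr' ?_ ?_
      · filter_upwards [self_mem_nhdsWithin] with t ht
        have ht : t ≠ 0 := ht
        rw [Finset.sum_range_succ', h0, zero_mul, add_zero, Finset.mul_sum]
        refine Finset.sum_congr rfl fun i _ => ?_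
        field_simp
        ring
      · filter_upwards [self_mem_nhdsWithin] with t ht
        have ht : t ≠ 0 := ht
        field_simp
        ring
    intro i hi
    cases i with
    | zero => exact h0
    | succ i => exact ih hsucc i (by omega)

/-- `HasJet f c₀ c₁ c₂ c₃` says that `f t = c₀ + c₁ t + c₂ t² + c₃ t³ + O(t⁴)` as `t → 0`. -/
def HasJet (f : ℝ → ℝ) (c₀ c₁ c₂ c₃ : ℝ) : Prop :=
  (fun t : ℝ => f t - (c₀ + c₁ * t + c₂ * t ^ 2 + c₃ * t ^ 3)) =O[𝓝 0] fun t => t ^ 4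

namespace HasJet

variable {f g : ℝ → ℝ} {a₀ a₁ a₂ a₃ b₀ b₁ b₂ b₃ : ℝ}

lemma unique (hf : HasJet f a₀ a₁ a₂ a₃) (hg : HasJet f b₀ b₁ b₂ b₃) :
    a₀ = b₀ ∧ a₁ = b₁ ∧ a₂ = b₂ ∧ a₃ = b₃ := by
  have h := (IsBigO.sub hg hf).mono (nhdsWithin_le_nhds (s := {0}ᶜ))
  let c : ℕ → ℝ := fun i =>
    match i with
    | 0 => a₀ - b₀
    | 1 => a₁ - b₁
    | 2 => a₂ - b₂
    | _ => a₃ - b₃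
  have hc := coeff_eq_zero_of_sum_isBigO (n := 4) (c := c) <| h.congr_left fun t => by
    simp only [Finset.sum_range_succ, Finset.sum_range_zero, c]; ring
  exact ⟨sub_eq_zero.1 (hc 0 (by norm_num)), sub_eq_zero.1 (hc 1 (by norm_num)),
    sub_eq_zero.1 (hc 2 (by norm_num)), sub_eq_zero.1 (hc 3 (by norm_num))⟩

lemma congr' (hf : HasJet f a₀ a₁ a₂ a₃) (h : f =ᶠ[𝓝 0] g) : HasJet g a₀ a₁ a₂ a₃ :=
  IsBigO.congr' hf (h.mono fun t ht => by simp only [ht]) EventuallyEq.rfl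

lemma add (hf : HasJet f a₀ a₁ a₂ a₃) (hg : HasJet g b₀ b₁ b₂ b₃) :
    HasJet (fun t => f t + g t) (a₀ + b₀) (a₁ + b₁) (a₂ + b₂) (a₃ + b₃) :=
  (IsBigO.add hf hg).congr_left fun t => by ring

lemma sub (hf : HasJet f a₀ a₁ a₂ a₃) (hg : HasJet g b₀ b₁ b₂ b₃) :
    HasJet (fun t => f t - g t) (a₀ - b₀) (a₁ - b₁) (a₂ - b₂) (a₃ - b₃) :=
  (IsBigO.sub hf hg).congr_left fun t => by ring

lemma const_mul (hf : HasJet f a₀ a₁ a₂ a₃) (c : ℝ) :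
    HasJet (fun t => c * f t) (c * a₀) (c * a₁) (c * a₂) (c * a₃) :=
  (IsBigO.const_mul_left hf c).congr_left fun t => by ring

lemma const (c : ℝ) : HasJet (fun _ => c) c 0 0 0 :=
  (isBigO_zero _ _).congr_left fun t => by ring

lemma id : HasJet (fun t => t) 0 1 0 0 :=
  (isBigO_zero _ _).congr_left fun t => by ring

lemma tendsto (hf : HasJet f a₀ a₁ a₂ a₃) : Tendsto f (𝓝 0) (𝓝 a₀) := by
  have h1 : Continuous fun t : ℝ => t ^ 4 := by fun_prop
  have h2 : Continuous fun t : ℝ => a₀ + a₁ * t + a₂ * t ^ 2 + a₃ * t ^ 3 := by fun_prop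
  have h3 : Tendsto (fun t : ℝ => t ^ 4) (𝓝 0) (𝓝 0) := by simpa using h1.tendsto 0
  simpa using (IsBigO.trans_tendsto hf h3).add (h2.tendsto 0)

lemma mul (hf : HasJet f a₀ a₁ a₂ a₃) (hg : HasJet g b₀ b₁ b₂ b₃) :
    HasJet (fun t => f t * g t) (a₀ * b₀) (a₀ * b₁ + a₁ * b₀) (a₀ * b₂ + a₁ * b₁ + a₂ * b₀)
      (a₀ * b₃ + a₁ * b₂ + a₂ * b₁ + a₃ * b₀) := by
  have h1 := IsBigO.mul hf (hg.tendsto.isBigO_one ℝ)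
  have hc : ∀ {φ : ℝ → ℝ}, Continuous φ → φ =O[𝓝 0] (fun _ => (1 : ℝ)) :=
    fun h => (h.tendsto 0).isBigO_one ℝ
  have h2 := IsBigO.mul (hc (φ := fun t => a₀ + a₁ * t + a₂ * t ^ 2 + a₃ * t ^ 3) (by fun_prop)) hg
  have h3 := IsBigO.mul (isBigO_refl (fun t : ℝ => t ^ 4) (𝓝 0))
    (hc (φ := fun t => (a₁ * b₃ + a₂ * b₂ + a₃ * b₁) + (a₂ * b₃ + a₃ * b₂) * t + a₃ * b₃ * t ^ 2)
      (by fun_prop))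
  simp only [mul_one, one_mul] at h1 h2 h3
  exact ((h1.add h2).add h3).congr_left fun t => by ring

lemma isBigO_id (hf : HasJet f 0 a₁ a₂ a₃) : f =O[𝓝 0] fun t => t := by
  have hc : ∀ {φ : ℝ → ℝ}, Continuous φ → φ =O[𝓝 0] (fun _ => (1 : ℝ)) :=
    fun h => (h.tendsto 0).isBigO_one ℝ
  have h1 := IsBigO.mul (isBigO_refl (fun t : ℝ => t) (𝓝 0))
    (hc (φ := fun t => t ^ 3) (by fun_prop))
  have h2 := IsBigO.mul (isBigO_refl (fun t : ℝ => t) (𝓝 0))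
    (hc (φ := fun t => a₁ + a₂ * t + a₃ * t ^ 2) (by fun_prop))
  simp only [mul_one] at h1 h2
  have h3 : (fun t : ℝ => t ^ 4) =O[𝓝 0] fun t => t := h1.congr_left fun t => by ring
  exact ((IsBigO.trans hf h3).add h2).congr_left fun t => by ring

lemma log (hf : HasJet f 1 a₁ a₂ a₃) :
    HasJet (fun t => Real.log (f t)) 0 a₁ (a₂ - a₁ ^ 2 / 2) (a₃ - a₁ * a₂ + a₁ ^ 3 / 3) := by
  have h1 : HasJet (fun t => f t - 1) 0 a₁ a₂ a₃ := by simpa using hf.sub (const 1)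
  have hO := h1.isBigO_id.pow 4
  have h0 := h1.tendsto
  have hlog : (fun t => Real.log (f t) -
      ((f t - 1) - (f t - 1) ^ 2 / 2 + (f t - 1) ^ 3 / 3)) =O[𝓝 0] fun t => t ^ 4 := by
    refine IsBigO.trans (IsBigO.of_bound 2 ?_) hO
    have hsmall : ∀ᶠ t in 𝓝 (0 : ℝ), |f t - 1| < 1 / 2 := by
      have := h0.abs
      rw [abs_zero] at this
      exact this.eventually_lt_const (by norm_num)
    filter_upwards [hsmall] with t ht
    have h2 := Real.abs_log_sub_add_sum_range_le (x := -(f t - 1)) (by rw [abs_neg]; linarith) 3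
    simp only [Finset.sum_range_succ, Finset.sum_range_zero, abs_neg] at h2
    rw [Real.norm_eq_abs, Real.norm_eq_abs, abs_pow]
    calc _ = _ := by congr 1; norm_num; ring
      _ ≤ _ := h2
      _ ≤ 2 * |f t - 1| ^ 4 := by
        rw [div_le_iff₀ (by linarith)]
        norm_num
        nlinarith [pow_nonneg (abs_nonneg (f t - 1)) 4]
  have h2 := h1.mul h1
  have h3 := h1.mul h2
  have h4 := (h1.sub (h2.const_mul (1 / 2))).add (h3.const_mul (1 / 3))
  exact (hlog.add h4).congr_left fun t => by ring

end HasJet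

/-! ### The critical equation as an analytic function -/

/-- With `z = l t / (c u)`, the critical equation for `u` at `θ = t` reads
`levelFun l (z, t) = t * Λ`. -/
def levelFun (l : ℝ) (y : ℝ × ℝ) : ℝ :=
  1 + y.2 * Real.log y.1 -
    (y.1 + l * y.2) * (1 - (Real.log (y.1 + l * y.2) - Real.log y.1) / l)

lemma contDiffAt_levelFun (l : ℝ) : ContDiffAt ℝ ⊤ (levelFun l) (1, 0) := by
  have h1 : ContDiffAt ℝ ⊤ (fun y : ℝ × ℝ => Real.log y.1) (1, 0) :=
    contDiffAt_fst.log (by norm_num)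
  have h2 : ContDiffAt ℝ ⊤ (fun y : ℝ × ℝ => y.1 + l * y.2) (1, 0) := by fun_prop
  have h3 : ContDiffAt ℝ ⊤ (fun y : ℝ × ℝ => Real.log (y.1 + l * y.2)) (1, 0) :=
    h2.log (by norm_num)
  unfold levelFun
  fun_prop

/-- The linear involution `(a, b) ↦ (-a + (1 - l) b, b)`, which is the differential of
`(z, t) ↦ (levelFun l (z, t), t)` at `(1, 0)`. -/
def linInvolution (l : ℝ) : (ℝ × ℝ) ≃L[ℝ] (ℝ × ℝ) :=
  let L : (ℝ × ℝ) →L[ℝ] (ℝ × ℝ) :=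
    (-ContinuousLinearMap.fst ℝ ℝ ℝ + (1 - l) • ContinuousLinearMap.snd ℝ ℝ ℝ).prod
      (ContinuousLinearMap.snd ℝ ℝ ℝ)
  ContinuousLinearEquiv.equivOfInverse L L (fun y => by simp [L]) (fun y => by simp [L])

lemma hasFDerivAt_levelFun_prod {l : ℝ} (hl : l ≠ 0) :
    HasFDerivAt (fun y : ℝ × ℝ => (levelFun l y, y.2))
      (linInvolution l : (ℝ × ℝ) →L[ℝ] (ℝ × ℝ)) (1, 0) := by
  have hfst : HasFDerivAt (fun y : ℝ × ℝ => y.1) (ContinuousLinearMap.fst ℝ ℝ ℝ) (1, 0) :=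
    hasFDerivAt_fst
  have hsnd : HasFDerivAt (fun y : ℝ × ℝ => y.2) (ContinuousLinearMap.snd ℝ ℝ ℝ) (1, 0) :=
    hasFDerivAt_snd
  have h1 := hfst.log (by norm_num)
  have h2 := hfst.add (hsnd.const_mul l)
  have h3 := h2.log (by norm_num)
  have h4 := ((hsnd.mul h1).const_add 1).sub (h2.mul (((h3.sub h1).mul_const l⁻¹).const_sub 1))
  refine (h4.prodMk hsnd).congr_fderiv ?_
  ext <;> simp [linInvolution, hl]
  ring

/-- The equation `levelFun l (z, t) = s` defines `z` near `1` as an analytic function of `(s, t)`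
near the origin. -/
lemma exists_analytic_solution {l : ℝ} (hl : l ≠ 0) :
    ∃ Z : ℝ × ℝ → ℝ, AnalyticAt ℝ Z 0 ∧ Z 0 = 1 ∧
      ∀ᶠ y in 𝓝 (0 : ℝ × ℝ), levelFun l (Z y, y.2) = y.1 := by
  have hc : ContDiffAt ℝ ⊤ (fun y : ℝ × ℝ => (levelFun l y, y.2)) (1, 0) :=
    (contDiffAt_levelFun l).prodMk contDiffAt_snd
  have hd := hasFDerivAt_levelFun_prod hl
  have h0 : (levelFun l (1, 0), (0 : ℝ)) = (0 : ℝ × ℝ) := by simp [levelFun]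
  have hs := hc.hasStrictFDerivAt' hd (by simp)
  let F : ℝ × ℝ → ℝ × ℝ := hs.localInverse _ _ _
  have hF : ContDiffAt ℝ ⊤ F 0 := by
    have := hc.to_localInverse hd (by simp)
    rw [h0] at this
    exact this
  have hF0 : F 0 = (1, 0) := by
    have := hs.localInverse_apply_image
    rw [h0] at this
    exact this
  have hright : ∀ᶠ y in 𝓝 (0 : ℝ × ℝ), (levelFun l (F y), (F y).2) = y := by
    have := hs.eventually_right_inverse
    rw [h0] at this
    exact this
  refine ⟨fun y => (F y).1, ?_, by simp [hF0], ?_⟩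
  · exact (contDiffAt_fst.comp (0 : ℝ × ℝ) hF).analyticAt
  · filter_upwards [hright] with y hy
    have h2 : (F y).2 = y.2 := (congrArg Prod.snd hy :)
    rw [← h2]
    exact (congrArg Prod.fst hy :)

/-- Along the ray `s = x t` a homogeneous expansion becomes a Taylor expansion in `t`. -/
lemma hasJet_of_homogeneous_expansion {f : ℝ × ℝ → ℝ} {P : ℕ → ℝ[X]}
    (hdeg : ∀ i, (P i).natDegree ≤ i)
    (hP : (fun y : ℝ × ℝ => f y - ∑ i ∈ Finset.range 4, homogEval (P i) i y) =O[𝓝 0]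
      fun y => ‖y‖ ^ 4) (x : ℝ) :
    HasJet (fun t => f (t * x, t)) ((P 0).eval x) ((P 1).eval x) ((P 2).eval x)
      ((P 3).eval x) := by
  have hcont : Continuous fun t : ℝ => (t * x, t) := by fun_prop
  have hlim : Tendsto (fun t : ℝ => (t * x, t)) (𝓝 0) (𝓝 0) := by
    simpa [← Prod.zero_eq_mk] using hcont.tendsto 0
  have h1 := hP.comp_tendsto hlim
  have h2 : (fun t : ℝ => ‖(t * x, t)‖) =O[𝓝 0] fun t => t := by
    refine IsBigO.norm_left (IsBigO.prod_left ?_ (isBigO_refl _ _))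
    simpa [mul_comm] using (isBigO_refl (fun t : ℝ => t) (𝓝 0)).const_mul_left x
  refine (h1.trans (h2.pow 4)).congr_left fun t => ?_
  simp only [Function.comp, Finset.sum_range_succ, Finset.sum_range_zero,
    homogEval_mul_self (hdeg _)]
  ring

/-- A homogeneous expansion of a function equal to `1 - s` on the line `t = 0` has no pure power
`s ^ i` with `2 ≤ i`. -/
lemma natDegree_le_of_eq_one_sub {f : ℝ × ℝ → ℝ} {P : ℕ → ℝ[X]}
    (hdeg : ∀ i, (P i).natDegree ≤ i)
    (hP : ∀ n : ℕ, (fun y : ℝ × ℝ => f y - ∑ i ∈ Finset.range n, homogEval (P i) i y) =O[𝓝 0]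
      fun y => ‖y‖ ^ n)
    (hf : ∀ᶠ s in 𝓝 (0 : ℝ), f (s, 0) = 1 - s) {i : ℕ} (hi : 2 ≤ i) :
    (P i).natDegree ≤ i - 1 := by
  refine Polynomial.natDegree_le_pred (hdeg i) ?_
  have hcont : Continuous fun s : ℝ => (s, (0 : ℝ)) := by fun_prop
  have hlim : Tendsto (fun s : ℝ => (s, (0 : ℝ))) (𝓝 0) (𝓝 0) := by
    simpa [← Prod.zero_eq_mk] using hcont.tendsto 0
  have h1 := (hP (i + 1)).comp_tendsto hlim
  have hdeg1 : (1 - X : ℝ[X]).natDegree < i + 1 := by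
    have : (1 - X : ℝ[X]).natDegree ≤ 1 := by compute_degree
    omega
  have h2 : (fun s : ℝ => ∑ j ∈ Finset.range (i + 1),
      ((1 - X : ℝ[X]).coeff j - (P j).coeff j) * s ^ j) =O[𝓝 0] fun s => s ^ (i + 1) := by
    refine (h1.congr' (f₂ := fun s : ℝ => ∑ j ∈ Finset.range (i + 1),
      ((1 - X : ℝ[X]).coeff j - (P j).coeff j) * s ^ j) (g₂ := fun s => ‖s ^ (i + 1)‖)
      ?_ ?_).of_norm_right
    · filter_upwards [hf] with s hs
      have h3 : (1 - s : ℝ) = (1 - X : ℝ[X]).eval s := by simp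
      simp only [Function.comp, hs, homogEval_snd_zero, sub_mul, Finset.sum_sub_distrib]
      rw [h3, Polynomial.eval_eq_sum_range' hdeg1]
    · exact Eventually.of_forall fun s => by simp
  have h3 := coeff_eq_zero_of_sum_isBigO (h2.mono nhdsWithin_le_nhds) i (Nat.lt_succ_self i)
  have h4 : (1 - X : ℝ[X]).coeff i = 0 := by
    rw [Polynomial.coeff_sub, Polynomial.coeff_one, Polynomial.coeff_X]
    simp [show i ≠ 0 by omega, show 1 ≠ i by omega]
  linarith

/-- The first Taylor coefficients along the ray `s = x t` of the solution of
`levelFun l (z, t) = s`: those of `z + l t` are `b₀, …, b₃`, those of `1 / z` are `a₀, …, a₃`. -/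
lemma jet_coeffs {l x : ℝ} (hl : l ≠ 0) {m w : ℝ → ℝ} {a₀ a₁ a₂ a₃ b₀ b₁ b₂ b₃ : ℝ}
    (hm : HasJet m b₀ b₁ b₂ b₃) (hw : HasJet w a₀ a₁ a₂ a₃) (h0 : Tendsto m (𝓝 0) (𝓝 1))
    (heq : ∀ᶠ t in 𝓝 (0 : ℝ), levelFun l (m t - l * t, t) = t * x)
    (hmw : ∀ᶠ t in 𝓝 (0 : ℝ), (m t - l * t) * w t = 1) :
    (a₀ = 1 ∧ a₁ = x + (l - 1) ∧
      a₂ = 1 / 2 * (2 * x ^ 2 + (4 * l - 2) * x + (2 * l ^ 2 - 3 * l))) ∧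
    b₀ = 1 ∧ b₁ = -(x - 1) ∧ b₂ = -(1 / 2 * (2 * x + l - 2)) ∧
      b₃ = -(1 / 6 * (3 * x ^ 2 + 3 * l * x + (l ^ 2 - 3))) := by
  obtain rfl : b₀ = 1 := tendsto_nhds_unique hm.tendsto h0
  have hz : HasJet (fun t => m t - l * t) 1 (b₁ - l) b₂ b₃ := by
    simpa using hm.sub (HasJet.id.const_mul l)
  have hlog := (hm.log.sub hz.log).const_mul l⁻¹
  have hlevel := (((HasJet.const 1).add (HasJet.id.mul hz.log)).sub
    (hm.mul ((HasJet.const 1).sub hlog))).congr' (g := fun t => x * t) <| by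
      filter_upwards [heq] with t ht
      rw [mul_comm x, ← ht, levelFun]
      simp only [sub_add_cancel]
      ring
  -- The equations are triangular: the `i`-th one is linear in `bᵢ`.
  obtain ⟨-, e₁, e₂, e₃⟩ := hlevel.unique (HasJet.id.const_mul x)
  obtain ⟨f₀, f₁, f₂, -⟩ := ((hz.mul hw).congr' (g := fun _ => 1) hmw).unique (HasJet.const 1)
  have hb₁ : b₁ = -(x - 1) := by
    field_simp at e₁
    exact mul_left_cancel₀ hl (by linear_combination -e₁)
  subst hb₁
  have hb₂ : b₂ = -(1 / 2 * (2 * x + l - 2)) := by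
    field_simp at e₂
    exact mul_left_cancel₀ hl (by linear_combination -(1 / 2) * e₂)
  subst hb₂
  have ha₀ : a₀ = 1 := by linarith
  subst ha₀
  have ha₁ : a₁ = x + (l - 1) := by linarith
  subst ha₁
  refine ⟨⟨rfl, rfl, by linear_combination f₂⟩, rfl, rfl, rfl, ?_⟩
  field_simp at e₃
  exact mul_left_cancel₀ hl (by linear_combination -(1 / 6) * e₃)

/-- The solution `Z` of the critical equation, with the homogeneous expansions of `1 / Z` and of
`Z + l t`. -/
lemma exists_solution_expansions {l : ℝ} (hl : l ≠ 0) :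
    ∃ (Z : ℝ × ℝ → ℝ) (A B : ℕ → ℝ[X]),
      Tendsto Z (𝓝 0) (𝓝 1) ∧
      (∀ᶠ y in 𝓝 (0 : ℝ × ℝ), levelFun l (Z y, y.2) = y.1) ∧
      (A 0 = 1 ∧ A 1 = X + C (l - 1) ∧
        A 2 = C (1 / 2) * (2 * X ^ 2 + C (4 * l - 2) * X + C (2 * l ^ 2 - 3 * l))) ∧
      (B 0 = 1 ∧ B 1 = -(X - 1) ∧ B 2 = -(C (1 / 2) * (2 * X + C l - 2)) ∧
        B 3 = -(C (1 / 6) * (3 * X ^ 2 + C (3 * l) * X + C (l ^ 2 - 3)))) ∧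
      (∀ i, (A i).natDegree ≤ i) ∧ (∀ i, (B i).natDegree ≤ i) ∧
      (∀ i, 2 ≤ i → (B i).natDegree ≤ i - 1) ∧
      (∀ n : ℕ, (fun y => 1 / Z y - ∑ i ∈ Finset.range n, homogEval (A i) i y) =O[𝓝 0]
        fun y => ‖y‖ ^ n) ∧
      (∀ n : ℕ, (fun y => Z y + l * y.2 - ∑ i ∈ Finset.range n, homogEval (B i) i y) =O[𝓝 0]
        fun y => ‖y‖ ^ n) := by
  obtain ⟨Z, hZ, hZ0, hlevel⟩ := exists_analytic_solution hl
  have hZ1 : Tendsto Z (𝓝 0) (𝓝 1) := by simpa [hZ0] using hZ.continuousAt.tendsto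
  have hsnd : AnalyticAt ℝ (fun y : ℝ × ℝ => y.2) 0 := analyticAt_snd
  have hM : AnalyticAt ℝ (fun y => Z y + l * y.2) 0 :=
    hZ.add (analyticAt_const.mul hsnd)
  have hW : AnalyticAt ℝ (fun y => 1 / Z y) 0 :=
    analyticAt_const.div hZ (by simp [hZ0])
  obtain ⟨A, hAdeg, hA⟩ := exists_homogeneous_expansion hW
  obtain ⟨B, hBdeg, hB⟩ := exists_homogeneous_expansion hM
  have hcoeffs := fun x : ℝ => by
    have hlim : Tendsto (fun t : ℝ => (t * x, t)) (𝓝 0) (𝓝 0) := by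
      have hcont : Continuous fun t : ℝ => (t * x, t) := by fun_prop
      simpa [← Prod.zero_eq_mk] using hcont.tendsto 0
    refine jet_coeffs (x := x) hl (hasJet_of_homogeneous_expansion hBdeg (hB 4) x)
      (hasJet_of_homogeneous_expansion hAdeg (hA 4) x) ?_ ?_ ?_
    · have h1 := hM.continuousAt.tendsto.comp hlim
      simpa [hZ0, Function.comp_def] using h1
    · filter_upwards [hlim.eventually hlevel] with t ht
      simpa using ht
    · filter_upwards [(hZ1.comp hlim).eventually_ne one_ne_zero] with t ht
      simp only [Function.comp] at ht
      field_simp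
      ring
  refine ⟨Z, A, B, hZ1, hlevel, ⟨?_, ?_, ?_⟩, ⟨?_, ?_, ?_, ?_⟩, hAdeg, hBdeg, ?_, hA, hB⟩
  · exact Polynomial.funext fun x => by simpa using (hcoeffs x).1.1
  · exact Polynomial.funext fun x => by simpa using (hcoeffs x).1.2.1
  · exact Polynomial.funext fun x => by simpa using (hcoeffs x).1.2.2
  · exact Polynomial.funext fun x => by simpa using (hcoeffs x).2.1
  · exact Polynomial.funext fun x => by simpa using (hcoeffs x).2.2.1
  · exact Polynomial.funext fun x => by simpa using (hcoeffs x).2.2.2.1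
  · exact Polynomial.funext fun x => by simpa using (hcoeffs x).2.2.2.2
  · intro i hi
    refine natDegree_le_of_eq_one_sub hBdeg hB ?_ hi
    have hlim : Tendsto (fun s : ℝ => (s, (0 : ℝ))) (𝓝 0) (𝓝 0) := by
      have hcont : Continuous fun s : ℝ => (s, (0 : ℝ)) := by fun_prop
      simpa [← Prod.zero_eq_mk] using hcont.tendsto 0
    filter_upwards [hlim.eventually hlevel] with s hs
    have h1 : 1 - Z (s, 0) = s := by simpa [levelFun] using hs
    simp only [mul_zero, add_zero]
    linarith

/-- A solution `z` of the critical equation determines the minimizer and the minimum of `h`. -/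
lemma pMin_and_mu_of_levelFun {q d k : ℕ} (hq : 2 ≤ q) (hd : 1 ≤ d) (hk : 1 ≤ k) {z : ℝ}
    (hz : 0 < z) (hz1 : lam q * theta q d k < ((q : ℝ) - 1) * z)
    (hlevel : levelFun (lam q) (z, theta q d k) = theta q d k * Lam q d k) :
    1 - Q q * pMin q d k = lam q / ((q : ℝ) - 1) * (theta q d k * (1 / z)) ∧
      mu q d k = kappa q k / lam q * (z + lam q * theta q d k) := by
  have hc := natCast_sub_one_pos hq
  have hl := lam_pos hq
  have ht := theta_pos hq hd hk
  have hmin := isMinimizer_pMin hq hd hk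
  have hΛ : Lam q d k = Real.log (theta q d k * lam q / ((q : ℝ) - 1)) := rfl
  have hmu := (mu_eq hq hd hk).trans (h_eq hq hk hmin.1)
  have huniq := fun u hu h0 => (isMinimizer_iff hq hd hk (u := u) hu h0 _).1 hmin
  generalize theta q d k = t at *
  generalize Lam q d k = Λ at *
  generalize hu : lam q / ((q : ℝ) - 1) * (t * (1 / z)) = u
  have hM : 0 < z + lam q * t := by positivity
  have hcu : ((q : ℝ) - 1) * u = lam q * t / z := by rw [← hu]; field_simp
  have hlogu : Real.log u = Λ - Real.log z := by
    have : u = t * lam q / ((q : ℝ) - 1) / z := by rw [← hu]; field_simp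
    rw [this, Real.log_div (by positivity) hz.ne', ← hΛ]
  have hlog1 : Real.log (1 + ((q : ℝ) - 1) * u) = Real.log (z + lam q * t) - Real.log z := by
    rw [← Real.log_div hM.ne' hz.ne', hcu]
    congr 1
    field_simp
  have hu0 : u ∈ Set.Ioo (0 : ℝ) 1 := by
    refine ⟨by rw [← hu]; positivity, ?_⟩
    rw [← hu, div_mul_eq_mul_div, mul_one_div, ← mul_div_assoc, div_div, div_lt_one (by positivity),
      mul_comm z]
    exact hz1
  rw [levelFun] at hlevel
  generalize Real.log (z + lam q * t) = LM at hlevel hlog1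
  have hcrit : (z + lam q * t) * (lam q - (LM - Real.log z)) = lam q * (1 - t * Real.log u) := by
    rw [hlogu]
    field_simp at hlevel
    linear_combination -hlevel
  have h0 : criticalFun ((q : ℝ) - 1) (lam q) t u = 0 := by
    have h1 : criticalFun ((q : ℝ) - 1) (lam q) t u = t / z * (lam q * (1 - t * Real.log u) -
        (z + lam q * t) * (lam q - (LM - Real.log z))) := by
      rw [criticalFun, hlog1, hcu]
      field_simp
    rw [h1, hcrit, sub_self, mul_zero]
  have hpu := huniq u hu0 h0
  refine ⟨hpu, ?_⟩
  have hden := denom_pos hc hu0.1 hu0.2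
  rw [log_one_add_natCast_sub_one, hlog1] at hden
  rw [hmu, hpu, reducedH, hlog1]
  field_simp
  linear_combination -kappa q k * hcrit

/-! ### The regime `k → ∞`, `d / k → 0` -/

lemma eventually_regime_one_le : ∀ᶠ x in regime, 1 ≤ x.1 ∧ 1 ≤ x.2 := by
  have h1 : ∀ᶠ x : ℕ × ℕ in 𝓟 {x : ℕ × ℕ | 1 ≤ x.1}, 1 ≤ x.1 := mem_principal_self _
  have h2 : ∀ᶠ x : ℕ × ℕ in comap (fun x : ℕ × ℕ => x.2) atTop, 1 ≤ x.2 :=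
    tendsto_comap.eventually (eventually_ge_atTop 1)
  exact (h1.filter_mono (inf_le_left.trans inf_le_left)).and
    (h2.filter_mono (inf_le_left.trans inf_le_right))

lemma tendsto_theta {q : ℕ} (hq : 2 ≤ q) :
    Tendsto (fun x : ℕ × ℕ => theta q x.1 x.2) regime (𝓝[>] 0) := by
  have hl := lam_pos hq
  have hk : ∀ᶠ x in regime, 2 ≤ x.2 :=
    (tendsto_comap.eventually (eventually_ge_atTop 2)).filter_mono
      (inf_le_left.trans inf_le_right)
  have hratio : Tendsto (fun x : ℕ × ℕ => (x.1 : ℝ) / (x.2 : ℝ)) regime (𝓝 0) :=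
    tendsto_comap.mono_left inf_le_right
  have hpos : ∀ᶠ x in regime, 0 < theta q x.1 x.2 :=
    eventually_regime_one_le.mono fun x hx => theta_pos hq hx.1 hx.2
  refine tendsto_nhdsWithin_iff.2 ⟨?_, hpos⟩
  refine squeeze_zero' (hpos.mono fun x hx => hx.le) ?_
    (by simpa using hratio.const_mul (2 / lam q))
  filter_upwards [hk] with x hx
  have hx' : (2 : ℝ) ≤ x.2 := by exact_mod_cast hx
  -- For `k ≥ 2`, `κ ≥ (k - 1) ln q ≥ (k / 2) ln q`.
  have hκ : lam q * x.2 / 2 ≤ kappa q x.2 := by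
    have h1 := log_sub_one_lt_lam hq
    have h2 : lam q * 2 ≤ lam q * x.2 := mul_le_mul_of_nonneg_left hx' hl.le
    rw [kappa, ← lam]
    linarith
  calc theta q x.1 x.2 ≤ x.1 / (lam q * x.2 / 2) := by
        rw [theta]; gcongr
    _ = 2 / lam q * (x.1 / x.2) := by field_simp

lemma tendsto_Lam {q : ℕ} (hq : 2 ≤ q) :
    Tendsto (fun x : ℕ × ℕ => Lam q x.1 x.2) regime atBot := by
  have hc := natCast_sub_one_pos hq
  have hl := lam_pos hq
  refine Real.tendsto_log_nhdsGT_zero.comp ?_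
  have h := tendsto_nhdsWithin_iff.1 (tendsto_theta hq)
  refine tendsto_nhdsWithin_iff.2 ⟨?_, ?_⟩
  · simpa using (h.1.mul_const (lam q)).div_const ((q : ℝ) - 1)
  · filter_upwards [h.2] with x hx
    have hx : 0 < theta q x.1 x.2 := hx
    exact Set.mem_Ioi.2 (by positivity)

lemma tendsto_theta_mul_Lam_sq {q : ℕ} (hq : 2 ≤ q) :
    Tendsto (fun x : ℕ × ℕ => theta q x.1 x.2 * Lam q x.1 x.2 ^ 2) regime (𝓝 0) := by
  have hc := natCast_sub_one_pos hq
  have hl := lam_pos hq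
  have h1 := (Real.tendsto_pow_mul_exp_neg_atTop_nhds_zero 2).comp
    (tendsto_neg_atBot_atTop.comp (tendsto_Lam hq))
  have h2 := h1.const_mul (((q : ℝ) - 1) / lam q)
  rw [mul_zero] at h2
  refine h2.congr' ?_
  filter_upwards [eventually_regime_one_le] with x hx
  have ht := theta_pos hq hx.1 hx.2
  simp only [Function.comp, neg_neg, even_two.neg_pow]
  rw [show Real.exp (Lam q x.1 x.2) = theta q x.1 x.2 * lam q / ((q : ℝ) - 1) from
    Real.exp_log (by positivity)]
  field_simp

/-- The point `(θ Λ, θ)` tends to the origin, and its norm is at most `θ |Λ|`. -/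
lemma tendsto_theta_Lam_prod {q : ℕ} (hq : 2 ≤ q) :
    Tendsto (fun x : ℕ × ℕ => (theta q x.1 x.2 * Lam q x.1 x.2, theta q x.1 x.2)) regime (𝓝 0) ∧
    (fun x : ℕ × ℕ => ‖(theta q x.1 x.2 * Lam q x.1 x.2, theta q x.1 x.2)‖) =O[regime]
      fun x => theta q x.1 x.2 * |Lam q x.1 x.2| := by
  have hO : (fun x : ℕ × ℕ => ‖(theta q x.1 x.2 * Lam q x.1 x.2, theta q x.1 x.2)‖) =O[regime]
      fun x => theta q x.1 x.2 * |Lam q x.1 x.2| := by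
    refine IsBigO.of_bound 1 ?_
    filter_upwards [eventually_regime_one_le, (tendsto_Lam hq).eventually_le_atBot (-1)]
      with x hx hΛ
    have ht := theta_pos hq hx.1 hx.2
    have hΛ' : 1 ≤ |Lam q x.1 x.2| := by rw [abs_of_neg (by linarith)]; linarith
    simp only [Prod.norm_mk, norm_mul, Real.norm_eq_abs, abs_of_pos ht, abs_abs, one_mul]
    rw [abs_of_nonneg (by positivity)]
    exact max_le le_rfl (le_mul_of_one_le_right ht.le hΛ')
  refine ⟨?_, hO⟩
  have h1 : Tendsto (fun x : ℕ × ℕ => theta q x.1 x.2 * |Lam q x.1 x.2|) regime (𝓝 0) := by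
    refine squeeze_zero' ?_ ?_ (tendsto_theta_mul_Lam_sq hq)
    · filter_upwards [eventually_regime_one_le] with x hx
      have ht := theta_pos hq hx.1 hx.2
      positivity
    · filter_upwards [eventually_regime_one_le, (tendsto_Lam hq).eventually_le_atBot (-1)]
        with x hx hΛ
      have ht := theta_pos hq hx.1 hx.2
      rw [abs_of_neg (by linarith)]
      gcongr
      nlinarith
  exact tendsto_zero_iff_norm_tendsto_zero.2 (hO.trans_tendsto h1)

lemma eval_Lam_isBigO {q m : ℕ} (hq : 2 ≤ q) {P : ℝ[X]} (hP : P.natDegree ≤ m) :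
    (fun x : ℕ × ℕ => P.eval (Lam q x.1 x.2)) =O[regime] fun x => |Lam q x.1 x.2| ^ m := by
  simp only [Polynomial.eval_eq_sum_range' (Nat.lt_succ_of_le hP)]
  suffices h : ∀ j ∈ Finset.range (m + 1),
      (fun x : ℕ × ℕ => P.coeff j * Lam q x.1 x.2 ^ j) =O[regime]
        fun x => |Lam q x.1 x.2| ^ m from IsBigO.fun_sum h
  intro j hj
  refine IsBigO.const_mul_left (IsBigO.of_bound 1 ?_) _
  filter_upwards [(tendsto_Lam hq).eventually_le_atBot (-1)] with x hΛ
  have hΛ' : 1 ≤ |Lam q x.1 x.2| := by rw [abs_of_neg (by linarith)]; linarith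
  simp only [norm_pow, Real.norm_eq_abs, abs_abs, one_mul]
  exact pow_le_pow_right₀ hΛ' (Nat.lt_succ_iff.1 (Finset.mem_range.1 hj))

/-- A homogeneous expansion evaluated at `(θ Λ, θ)`. -/
lemma expansion_comp_regime {q n : ℕ} (hq : 2 ≤ q) {f : ℝ × ℝ → ℝ} {P : ℕ → ℝ[X]}
    (hdeg : ∀ i, (P i).natDegree ≤ i)
    (hP : (fun y : ℝ × ℝ => f y - ∑ i ∈ Finset.range n, homogEval (P i) i y) =O[𝓝 0]
      fun y => ‖y‖ ^ n) :
    (fun x : ℕ × ℕ => f (theta q x.1 x.2 * Lam q x.1 x.2, theta q x.1 x.2) -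
      ∑ i ∈ Finset.range n, (P i).eval (Lam q x.1 x.2) * theta q x.1 x.2 ^ i) =O[regime]
      fun x => (theta q x.1 x.2 * |Lam q x.1 x.2|) ^ n := by
  obtain ⟨hlim, hO⟩ := tendsto_theta_Lam_prod hq
  refine ((hP.comp_tendsto hlim).trans (hO.pow n)).congr_left fun x => ?_
  simp only [Function.comp, homogEval_mul_self (hdeg _)]

/-- The coefficient of `θ ^ (r + 1)` having degree at most `max 1 r` in `Λ`, and `θ Λ ^ 2` being
bounded, the expansion truncated at order `r` has an error smaller than the norm of the argument
suggests. -/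
lemma truncation_isBigO {q : ℕ} (hq : 2 ≤ q) {f : ℝ × ℝ → ℝ} {P : ℕ → ℝ[X]}
    (hdeg : ∀ i, (P i).natDegree ≤ i) (r : ℕ) (hr : (P (r + 1)).natDegree ≤ max 1 r)
    (hP : (fun y : ℝ × ℝ => f y - ∑ i ∈ Finset.range (r + 2), homogEval (P i) i y) =O[𝓝 0]
      fun y => ‖y‖ ^ (r + 2)) :
    (fun x : ℕ × ℕ => f (theta q x.1 x.2 * Lam q x.1 x.2, theta q x.1 x.2) -
      ∑ i ∈ Finset.range (r + 1), (P i).eval (Lam q x.1 x.2) * theta q x.1 x.2 ^ i) =O[regime]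
      fun x => theta q x.1 x.2 ^ (r + 1) * |Lam q x.1 x.2| ^ max 1 r := by
  have h1 := expansion_comp_regime hq hdeg hP
  have h2 : (fun x : ℕ × ℕ => (theta q x.1 x.2 * |Lam q x.1 x.2|) ^ (r + 2)) =O[regime]
      fun x => theta q x.1 x.2 ^ (r + 1) * |Lam q x.1 x.2| ^ max 1 r := by
    have h3 := (isBigO_refl (fun x : ℕ × ℕ => theta q x.1 x.2 ^ (r + 1) *
      |Lam q x.1 x.2| ^ max 1 r) regime).mul ((tendsto_theta_mul_Lam_sq hq).isBigO_one ℝ)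
    simp only [mul_one] at h3
    refine (IsBigO.of_bound 1 ?_).trans h3
    filter_upwards [eventually_regime_one_le, (tendsto_Lam hq).eventually_le_atBot (-1)]
      with x hx hΛ
    have ht := theta_pos hq hx.1 hx.2
    have hΛ' : 1 ≤ |Lam q x.1 x.2| := by rw [abs_of_neg (by linarith)]; linarith
    rw [one_mul, ← sq_abs (Lam q x.1 x.2), Real.norm_of_nonneg (by positivity),
      Real.norm_of_nonneg (by positivity)]
    generalize |Lam q x.1 x.2| = a at *
    calc (theta q x.1 x.2 * a) ^ (r + 2) = theta q x.1 x.2 ^ (r + 2) * a ^ (r + 2) := mul_pow _ _ _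
      _ ≤ theta q x.1 x.2 ^ (r + 2) * a ^ (max 1 r + 2) := by
        gcongr
        exact le_max_right 1 r
      _ = _ := by ring
  have h4 := (isBigO_refl (fun x : ℕ × ℕ => theta q x.1 x.2 ^ (r + 1)) regime).mul
    (eval_Lam_isBigO hq hr)
  refine ((h1.trans h2).add h4).congr_left fun x => ?_
  rw [Finset.sum_range_succ _ (r + 1)]
  ring

end ErrorDetection

end

theorem mainTheorem4 (q : ℕ) (hq : 2 ≤ q) :
    (∀ d k : ℕ, 1 ≤ d → 1 ≤ k →
      (∃! p : ℝ, ErrorDetection.IsMinimizer q d k p) ∧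
      IsLeast (ErrorDetection.h q d k '' ErrorDetection.probInterval q)
        (ErrorDetection.mu q d k)) ∧
    ∃ A B : ℕ → ℝ[X],
      A 1 = 1 ∧
      A 2 = X + C (ErrorDetection.lam q - 1) ∧
      A 3 = C (1 / 2) * (2 * X ^ 2 + C (4 * ErrorDetection.lam q - 2) * X +
        C (2 * ErrorDetection.lam q ^ 2 - 3 * ErrorDetection.lam q)) ∧
      B 0 = 1 ∧
      B 1 = -(X - 1) ∧
      B 2 = -(C (1 / 2) * (2 * X + C (ErrorDetection.lam q) - 2)) ∧
      B 3 = -(C (1 / 6) * (3 * X ^ 2 + C (3 * ErrorDetection.lam q) * X +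
        C (ErrorDetection.lam q ^ 2 - 3))) ∧
      ∀ r : ℕ,
        (fun x : ℕ × ℕ =>
          1 - ErrorDetection.Q q * ErrorDetection.pMin q x.1 x.2 -
            ErrorDetection.lam q / ((q : ℝ) - 1) *
              ∑ i ∈ Finset.Icc 1 r,
                (A i).eval (ErrorDetection.Lam q x.1 x.2) *
                  ErrorDetection.theta q x.1 x.2 ^ i)
          =O[ErrorDetection.regime]
          (fun x : ℕ × ℕ =>
            ErrorDetection.theta q x.1 x.2 ^ (r + 1) *
              |ErrorDetection.Lam q x.1 x.2| ^ r) ∧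
        (fun x : ℕ × ℕ =>
          ErrorDetection.mu q x.1 x.2 -
            ErrorDetection.kappa q x.2 / ErrorDetection.lam q *
              ∑ i ∈ Finset.Icc 0 r,
                (B i).eval (ErrorDetection.Lam q x.1 x.2) *
                  ErrorDetection.theta q x.1 x.2 ^ i)
          =O[ErrorDetection.regime]
          (fun x : ℕ × ℕ =>
            ErrorDetection.kappa q x.2 * (ErrorDetection.theta q x.1 x.2 ^ (r + 1) *
              |ErrorDetection.Lam q x.1 x.2| ^ max 1 r)) := by
  refine ⟨fun d k hd hk => ⟨ErrorDetection.existsUnique_isMinimizer hq hd hk, ?_⟩, ?_⟩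
  · rw [ErrorDetection.mu_eq hq hd hk]
    exact ErrorDetection.isLeast_h_pMin hq hd hk
  have hc := ErrorDetection.natCast_sub_one_pos hq
  have hl := ErrorDetection.lam_pos hq
  obtain ⟨Z, A, B, hZ, hlevel, ⟨hA0, hA1, hA2⟩, ⟨hB0, hB1, hB2, hB3⟩,
      hAdeg, hBdeg, hBdeg', hA, hB⟩ :=
    ErrorDetection.exists_solution_expansions hl.ne'
  obtain ⟨hlim, -⟩ := ErrorDetection.tendsto_theta_Lam_prod hq
  have hZ' := hZ.comp hlim
  have hθ := (tendsto_nhdsWithin_iff.1 (ErrorDetection.tendsto_theta hq)).1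
  -- In the regime, the minimizer and the minimum are given by `Z` at `(θ Λ, θ)`.
  have hkey : ∀ᶠ x in ErrorDetection.regime,
      1 - ErrorDetection.Q q * ErrorDetection.pMin q x.1 x.2 =
        ErrorDetection.lam q / ((q : ℝ) - 1) * (ErrorDetection.theta q x.1 x.2 *
          (1 / Z (ErrorDetection.theta q x.1 x.2 * ErrorDetection.Lam q x.1 x.2,
            ErrorDetection.theta q x.1 x.2))) ∧
      ErrorDetection.mu q x.1 x.2 = ErrorDetection.kappa q x.2 / ErrorDetection.lam q *
        (Z (ErrorDetection.theta q x.1 x.2 * ErrorDetection.Lam q x.1 x.2,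
          ErrorDetection.theta q x.1 x.2) +
            ErrorDetection.lam q * ErrorDetection.theta q x.1 x.2) := by
    have hsmall : ∀ᶠ x in ErrorDetection.regime,
        ErrorDetection.lam q * ErrorDetection.theta q x.1 x.2 <
          ((q : ℝ) - 1) * Z (ErrorDetection.theta q x.1 x.2 * ErrorDetection.Lam q x.1 x.2,
            ErrorDetection.theta q x.1 x.2) :=
      (hθ.const_mul (ErrorDetection.lam q)).eventually_lt (hZ'.const_mul ((q : ℝ) - 1))
        (by simpa using hc)
    filter_upwards [ErrorDetection.eventually_regime_one_le, hlim.eventually hlevel,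
      hZ'.eventually_const_lt zero_lt_one, hsmall] with x hx hx1 hx2 hx3
    exact ErrorDetection.pMin_and_mu_of_levelFun hq hx.1 hx.2 hx2 hx3 hx1
  -- The factor `θ` in `1 - Q p_m = (l / c) θ / Z` shifts the index of the coefficients of `1 / Z`.
  refine ⟨fun i => A (i - 1), B, hA0, hA1, hA2, hB0, hB1, hB2, hB3, fun r => ⟨?_, ?_⟩⟩
  · have h1 := ErrorDetection.expansion_comp_regime hq hAdeg (hA r)
    have h2 := ((isBigO_refl (fun x : ℕ × ℕ => ErrorDetection.theta q x.1 x.2)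
      ErrorDetection.regime).mul h1).const_mul_left (ErrorDetection.lam q / ((q : ℝ) - 1))
    refine h2.congr' ?_ (Eventually.of_forall fun x => by ring)
    filter_upwards [hkey] with x hx
    rw [hx.1, ← mul_sub, mul_sub (ErrorDetection.theta q x.1 x.2)]
    congr 2
    rw [← Finset.Ico_add_one_right_eq_Icc, Finset.sum_Ico_eq_sum_range, Finset.mul_sum]
    refine Finset.sum_congr (by simp) fun i _ => ?_
    rw [Nat.add_sub_cancel_left]
    ring
  · have hr : (B (r + 1)).natDegree ≤ max 1 r := by
      rcases Nat.eq_zero_or_pos r with rfl | hr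
      · exact hBdeg 1
      · exact (hBdeg' (r + 1) (by omega)).trans (le_max_right 1 r)
    have h1 := ErrorDetection.truncation_isBigO hq hBdeg r hr (hB (r + 2))
    have h2 := ((isBigO_refl (fun x : ℕ × ℕ => ErrorDetection.kappa q x.2)
      ErrorDetection.regime).mul h1).const_mul_left (ErrorDetection.lam q)⁻¹
    refine h2.congr' ?_ EventuallyEq.rfl
    filter_upwards [hkey] with x hx
    rw [hx.2, ← Nat.range_succ_eq_Icc_zero, ← mul_sub]
    simp only [div_eq_mul_inv]
    ring
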